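/- A two-player miner's dilemma game with betrayal is given by real numbers $m, m_1, m_2 > 0$ with $m_1 + m_2 \le m$ (the total mining power and the mining powers of pools 1 and 2) and a betrayal parameter $p \in [0,1)$. Pool $i$ chooses $x_i \in [0, m_i]$, the mining power with which it infiltrates the other pool. Put $M = m-(1-p)(x_1+x_2)$. The direct rewards are $R_1 = (m_1 - x_1 + p x_2)/M$ and $R_2 = (m_2 - x_2 + p x_1)/M$ (both $0$ if $M = 0$), and the average rewards $r_1, r_2$ are the solution of $r_1 = (R_1 + x_1 r_2)/(m_1 + x_2)$, $r_2 = (R_2 + x_2 r_1)/(m_2 + x_1)$, that is, $$r_1 = \frac{m_1 m_2 + m_1 x_1 + p m_2 x_2 - (1-p)x_1^2 - (1-p)x_1x_2}{M\,(m_1m_2 + m_1x_1 + m_2x_2)},$$ and symmetrically for $r_2$. A pure Nash equilibrium is a profile $(x_1^*, x_2^*)$ such that $x_1^*$ maximizes $r_1(\cdot, x_2^*)$ on $[0,m_1]$ and $x_2^*$ maximizes $r_2(x_1^*, \cdot)$ on $[0,m_2]$. The social welfare of a profile is the effective mining power $m_1+m_2-(1-p)(x_1+x_2)$ of the two pools,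 and the pure price of anarchy $\mathrm{PPoA}$ is the optimal social welfare divided by the worst social welfare in a pure Nash equilibrium. Theorem. In every such game there is a unique pure Nash equilibrium $(x_1^*, x_2^*)$, so that $$\mathrm{PPoA} = \frac{m_1+m_2}{m_1+m_2-(1-p)(x_1^*+x_2^*)},$$ and $1 < \mathrm{PPoA} \le \frac{2}{1+p} \le 2$. Moreover $\mathrm{PPoA} = 2$ if and only if $m_1 = m_2 = m/2$ and $p = 0$. The bounds are tight: values of $\mathrm{PPoA}$ arbitrarily close to $1$ occur, and the set of values of $\mathrm{PPoA}$ over all such games is exactly $(1, 2]$. -/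

import Mathlib

/-- A two-player miner's dilemma game with betrayal: `m` is the total mining power of the system,
`m₁` and `m₂` are the mining powers of the two pools (the rest, `m - m₁ - m₂ ≥ 0`, does not take
part in the game), and `p ∈ [0, 1)` is the betrayal parameter. -/
structure MinersDilemma where
  m : ℝ
  m₁ : ℝ
  m₂ : ℝ
  p : ℝ
  m₁_pos : 0 < m₁
  m₂_pos : 0 < m₂
  add_le : m₁ + m₂ ≤ m
  p_nonneg : 0 ≤ p
  p_lt_one : p < 1

noncomputable section

namespace MinersDilemma

/-- Pure strategy profiles: pool `i` infiltrates the other pool with power `xᵢ ∈ [0, mᵢ]`. -/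
def profiles (G : MinersDilemma) : Set (ℝ × ℝ) :=
  Set.Icc 0 G.m₁ ×ˢ Set.Icc 0 G.m₂

/-- Effective mining power of pool 1. -/
def power₁ (G : MinersDilemma) (x₁ x₂ : ℝ) : ℝ := G.m₁ - x₁ + G.p * x₂

/-- Effective mining power of pool 2. -/
def power₂ (G : MinersDilemma) (x₁ x₂ : ℝ) : ℝ := G.m₂ - x₂ + G.p * x₁

/-- Total effective mining power of the system. -/
def totalPower (G : MinersDilemma) (x₁ x₂ : ℝ) : ℝ := G.m - (1 - G.p) * (x₁ + x₂)

/-- Direct reward of pool 1.  If the total effective power is `0` then nobody mines and the direct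
rewards are `0` (this is the value that division by `0` gives). -/
def direct₁ (G : MinersDilemma) (x₁ x₂ : ℝ) : ℝ := G.power₁ x₁ x₂ / G.totalPower x₁ x₂

/-- Direct reward of pool 2. -/
def direct₂ (G : MinersDilemma) (x₁ x₂ : ℝ) : ℝ := G.power₂ x₁ x₂ / G.totalPower x₁ x₂

/-- Average reward of pool 1, in closed form; see `reward_system` for the equations that
determine it. -/
def reward₁ (G : MinersDilemma) (x₁ x₂ : ℝ) : ℝ :=
  (G.m₁ * G.m₂ + G.m₁ * x₁ + G.p * G.m₂ * x₂ - (1 - G.p) * x₁ ^ 2 - (1 - G.p) * x₁ * x₂) /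
    (G.totalPower x₁ x₂ * (G.m₁ * G.m₂ + G.m₁ * x₁ + G.m₂ * x₂))

/-- Average reward of pool 2, in closed form. -/
def reward₂ (G : MinersDilemma) (x₁ x₂ : ℝ) : ℝ :=
  (G.m₁ * G.m₂ + G.m₂ * x₂ + G.p * G.m₁ * x₁ - (1 - G.p) * x₂ ^ 2 - (1 - G.p) * x₁ * x₂) /
    (G.totalPower x₁ x₂ * (G.m₁ * G.m₂ + G.m₁ * x₁ + G.m₂ * x₂))

/-- The average rewards are the unique solution of the equations that define them: the average
reward of a pool is its direct reward plus what its infiltrators earn in the other pool, divided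
by the mining power that is registered in the pool. -/
theorem reward_system (G : MinersDilemma) {x₁ x₂ : ℝ} (hx₁ : 0 ≤ x₁) (hx₂ : 0 ≤ x₂) (a b : ℝ) :
    (a = (G.direct₁ x₁ x₂ + x₁ * b) / (G.m₁ + x₂) ∧
      b = (G.direct₂ x₁ x₂ + x₂ * a) / (G.m₂ + x₁)) ↔
    (a = G.reward₁ x₁ x₂ ∧ b = G.reward₂ x₁ x₂) := by
  have h₁ := G.m₁_pos
  have h₂ := G.m₂_pos
  have hA : G.m₁ + x₂ ≠ 0 := by positivity
  have hB : G.m₂ + x₁ ≠ 0 := by positivity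
  have hD : G.m₁ * G.m₂ + G.m₁ * x₁ + G.m₂ * x₂ ≠ 0 := by positivity
  have e₁ : G.reward₁ x₁ x₂ * (G.m₁ * G.m₂ + G.m₁ * x₁ + G.m₂ * x₂) =
      G.direct₁ x₁ x₂ * (G.m₂ + x₁) + x₁ * G.direct₂ x₁ x₂ := by
    unfold reward₁ direct₁ direct₂ power₁ power₂
    rw [← div_div, div_mul_cancel₀ _ hD]
    ring
  have e₂ : G.reward₂ x₁ x₂ * (G.m₁ * G.m₂ + G.m₁ * x₁ + G.m₂ * x₂) =
      G.direct₂ x₁ x₂ * (G.m₁ + x₂) + x₂ * G.direct₁ x₁ x₂ := by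
    unfold reward₂ direct₁ direct₂ power₁ power₂
    rw [← div_div, div_mul_cancel₀ _ hD]
    ring
  rw [eq_div_iff hA, eq_div_iff hB]
  constructor
  · rintro ⟨ha, hb⟩
    constructor
    · apply mul_right_cancel₀ hD
      linear_combination (G.m₂ + x₁) * ha + x₁ * hb - e₁
    · apply mul_right_cancel₀ hD
      linear_combination (G.m₁ + x₂) * hb + x₂ * ha - e₂
  · rintro ⟨rfl, rfl⟩
    constructor
    · apply mul_right_cancel₀ hD
      linear_combination (G.m₁ + x₂) * e₁ - x₁ * e₂
    · apply mul_right_cancel₀ hD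
      linear_combination (G.m₂ + x₁) * e₂ - x₂ * e₁

/-- A pure Nash equilibrium: each pool's average reward is maximal given the other's strategy. -/
def IsPureNash (G : MinersDilemma) (x : ℝ × ℝ) : Prop :=
  x ∈ G.profiles ∧
    IsMaxOn (fun y => G.reward₁ y x.2) (Set.Icc 0 G.m₁) x.1 ∧
    IsMaxOn (fun y => G.reward₂ x.1 y) (Set.Icc 0 G.m₂) x.2

/-- Social welfare: the effective mining power of the two pools together. -/
def welfare (G : MinersDilemma) (x : ℝ × ℝ) : ℝ := G.power₁ x.1 x.2 + G.power₂ x.1 x.2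

/-- Pure price of anarchy: the optimal social welfare divided by the worst social welfare in a pure
Nash equilibrium. -/
def PPoA (G : MinersDilemma) : ℝ :=
  sSup (G.welfare '' G.profiles) / sInf (G.welfare '' {x | G.IsPureNash x})

end MinersDilemma

end

/-! ### The exchanged game and the polynomial first-order condition -/

namespace MinersDilemma

/-! Write `F₁`, `F₂` for the marginals of the two pools, `M` for the total power, `D` for the
determinant and `σ = x + y`. While `M > 0`, a strategy is a best response exactly when it satisfies
the first-order condition on `F` (`numer_cross`, `descent_pos`), so equilibria are solutions of
polynomial inequalities.

The identity `m₁ F₁ + m₂ F₂ = M m₁ m₂ (m₁ m₂ - σ²) - (m - m₁ - m₂) D²` (`weighted_marginal_sum`)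
does most of the work. If both pools infiltrate, then `F₁, F₂ ≥ 0`, hence `σ² ≤ m₁ m₂` and `σ ≤ (m₁
+ m₂) / 2` by AM-GM; if only one does, it uses at most half its power. This is the bound `2 / (1 +
p)`, and equality forces equal pools that own everything.

Uniqueness: the identity excludes two equilibria ordered the same way in both coordinates. Those
ordered in opposite ways are excluded because `F₁ / D²` strictly decreases when infiltration moves
from pool 2 to pool 1 at constant `σ` (`marginal_shift_lt`). Existence is an intermediate value
argument along the best response of pool 2. -/

/-- The game with the roles of the two pools exchanged. -/
def swap (G : MinersDilemma) : MinersDilemma where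
  m := G.m
  m₁ := G.m₂
  m₂ := G.m₁
  p := G.p
  m₁_pos := G.m₂_pos
  m₂_pos := G.m₁_pos
  add_le := by linarith [G.add_le]
  p_nonneg := G.p_nonneg
  p_lt_one := G.p_lt_one

/-- The determinant of the linear system that defines the average rewards. -/
def det (G : MinersDilemma) (x y : ℝ) : ℝ := G.m₁ * G.m₂ + G.m₁ * x + G.m₂ * y

/-- A polynomial with the sign of the partial derivative of `reward₁` in its first argument. -/
def marginal (G : MinersDilemma) (x y : ℝ) : ℝ :=
  G.det x y ^ 2 - (1 - G.p) * (x ^ 2 + x * y + G.m₂ * y) * G.det x y -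
    G.totalPower x y * (G.m₁ * x ^ 2 + 2 * G.m₂ * (G.m₁ + y) * x + G.m₂ * y ^ 2)

/-- Minus half of the partial derivative of `marginal` in its first argument. -/
def descent (G : MinersDilemma) (x y : ℝ) : ℝ :=
  (G.m - G.m₁ - G.m₂) * G.det x y +
    G.m₂ * (G.det x y - (1 - G.p) * (G.m₁ * x + x * y + y ^ 2))

/-- First-order condition for `x` to be a best response of pool 1 to `y`. -/
def IsCritical (G : MinersDilemma) (x y : ℝ) : Prop :=
  x ∈ Set.Icc 0 G.m₁ ∧ ∀ e ∈ Set.Icc 0 G.m₁, (e - x) * G.marginal x y ≤ 0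

theorem totalPower_swap (G : MinersDilemma) (x y : ℝ) :
    G.swap.totalPower y x = G.totalPower x y := by
  simp only [totalPower, swap]; ring

theorem reward₁_swap (G : MinersDilemma) (x y : ℝ) : G.swap.reward₁ y x = G.reward₂ x y := by
  simp only [reward₁, reward₂, totalPower, swap]
  congr 1 <;> ring

theorem reward₂_swap (G : MinersDilemma) (x y : ℝ) : G.swap.reward₂ y x = G.reward₁ x y := by
  simp only [reward₁, reward₂, totalPower, swap]
  congr 1 <;> ring

theorem IsPureNash.swap {G : MinersDilemma} {x : ℝ × ℝ} (h : G.IsPureNash x) :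
    G.swap.IsPureNash (x.2, x.1) := by
  obtain ⟨⟨h1, h2⟩, h3, h4⟩ := h
  refine ⟨⟨h2, h1⟩, ?_, ?_⟩
  · simp only [reward₁_swap]
    exact h4
  · simp only [reward₂_swap]
    exact h3

/-! ### Signs and monotonicity of the marginal -/

section estimates

variable (G : MinersDilemma) {x y : ℝ}

theorem det_pos (hx : 0 ≤ x) (hy : 0 ≤ y) : 0 < G.det x y := by
  have := G.m₁_pos
  have := G.m₂_pos
  unfold det; positivity

theorem totalPower_nonneg (hx : x ≤ G.m₁) (hy : y ≤ G.m₂) : 0 ≤ G.totalPower x y := by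
  have := G.m₁_pos
  have := G.m₂_pos
  have := G.p_nonneg
  have := G.p_lt_one
  have := G.add_le
  unfold totalPower
  nlinarith [mul_nonneg (sub_nonneg.2 this) G.p_nonneg,
    mul_le_mul_of_nonneg_left (add_le_add hx hy) (sub_nonneg.2 G.p_lt_one.le)]

theorem totalPower_lower : (1 - G.p) * (G.m₁ + G.m₂ - (x + y)) ≤ G.totalPower x y := by
  have := G.m₁_pos
  have := G.m₂_pos
  have := G.p_nonneg
  have := G.add_le
  unfold totalPower
  nlinarith

theorem totalPower_pos_of_le {x' y' : ℝ} (h : 0 < G.totalPower x y) (hx : x' ≤ x) (hy : y' ≤ y) :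
    0 < G.totalPower x' y' := by
  have := G.p_lt_one
  unfold totalPower at *
  nlinarith

theorem totalPower_pos_of_lt (hx : x < G.m₁) (hy : y ≤ G.m₂) : 0 < G.totalPower x y :=
  (mul_pos (sub_pos.2 G.p_lt_one) (by linarith)).trans_le G.totalPower_lower

/-- This makes the marginal strictly decreasing in a pool's own strategy. The hypothesis on total
power is needed: `descent` vanishes at `(m₁, m₂)` when `p = 0` and `m = m₁ + m₂`, the one case of
zero total power. -/
theorem descent_pos (hx : x ∈ Set.Icc 0 G.m₁) (hy : y ∈ Set.Icc 0 G.m₂)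
    (hM : 0 < G.totalPower x y) : 0 < G.descent x y := by
  obtain ⟨hx0, hx1⟩ := hx
  obtain ⟨hy0, hy1⟩ := hy
  have hD := G.det_pos hx0 hy0
  have ha := G.m₁_pos
  have hb := G.m₂_pos
  have hp := G.p_nonneg
  have hp1 := G.p_lt_one
  have hm := G.add_le
  have hxy : x * y ≤ G.m₁ * G.m₂ := mul_le_mul hx1 hy1 hy0 ha.le
  have hW : 0 ≤ G.m₁ * x + x * y + y ^ 2 := by positivity
  have h1 : G.det x y - (G.m₁ * x + x * y + y ^ 2) =
      (G.m₁ * G.m₂ - x * y) + y * (G.m₂ - y) := by unfold det; ring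
  have h2 : 0 ≤ y * (G.m₂ - y) := mul_nonneg hy0 (sub_nonneg.2 hy1)
  have h3 : 0 ≤ (G.m - G.m₁ - G.m₂) * G.det x y := mul_nonneg (by linarith) hD.le
  unfold descent
  by_cases hc : G.m₁ + G.m₂ < G.m
  · have h4 : 0 < (G.m - G.m₁ - G.m₂) * G.det x y := mul_pos (by linarith) hD
    have h5 : 0 ≤ G.det x y - (1 - G.p) * (G.m₁ * x + x * y + y ^ 2) := by nlinarith
    nlinarith [mul_nonneg hb.le h5]
  · have h5 : 0 < G.det x y - (1 - G.p) * (G.m₁ * x + x * y + y ^ 2) := by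
      rcases hp.eq_or_lt with h0 | h0
      · have : x * y < G.m₁ * G.m₂ := by
          unfold totalPower at hM
          rw [← h0] at hM
          rcases hx1.lt_or_eq with h | h
          · nlinarith
          · nlinarith
        rw [← h0]; linarith
      · by_cases hW0 : 0 < G.m₁ * x + x * y + y ^ 2
        · nlinarith
        · have : G.m₁ * x + x * y + y ^ 2 = 0 := by linarith
          rw [this]; linarith
    nlinarith [mul_pos hb h5]

/-- For fixed `y`, `descent` is affine in `x`, so the trapezoid rule for its integral is exact. -/
theorem marginal_sub (x x' y : ℝ) :
    G.marginal x' y - G.marginal x y = -(x' - x) * (G.descent x y + G.descent x' y) := by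
  unfold marginal descent totalPower det; ring

theorem marginal_lt {x' : ℝ} (hx : 0 ≤ x) (hxx : x < x') (hx' : x' ≤ G.m₁)
    (hy : y ∈ Set.Icc 0 G.m₂) (hM : 0 < G.totalPower x' y) :
    G.marginal x' y < G.marginal x y := by
  have h1 := G.descent_pos ⟨hx, hxx.le.trans hx'⟩ hy (G.totalPower_pos_of_le hM hxx.le le_rfl)
  have h2 := G.descent_pos ⟨hx.trans hxx.le, hx'⟩ hy hM
  have := mul_pos (sub_pos.2 hxx) (add_pos h1 h2)
  linarith [G.marginal_sub x x' y]

/-- With these weights the sum depends on the profile only through `M`, `D` and `x + y`; when the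
pools own everything, its sign is that of `m₁ m₂ - (x + y)²` wherever `M > 0`. -/
theorem weighted_marginal_sum (x y : ℝ) :
    G.m₁ * G.marginal x y + G.m₂ * G.swap.marginal y x =
      G.totalPower x y * (G.m₁ * G.m₂ * (G.m₁ * G.m₂ - (x + y) ^ 2)) -
        (G.m - G.m₁ - G.m₂) * G.det x y ^ 2 := by
  unfold marginal totalPower det swap; ring

theorem marginal_shift_identity (x y t : ℝ) :
    G.marginal (x + t) (y - t) * G.det x y ^ 2 - G.marginal x y * G.det (x + t) (y - t) ^ 2 =
      t * ((1 - G.p) * G.m₂ * (G.m₁ * G.m₂ - (x + y) ^ 2) * G.det x y * G.det (x + t) (y - t) -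
        G.totalPower x y * (2 * G.m₁ * G.m₂ * G.det x y * G.det (x + t) (y - t) +
          (G.m₂ - G.m₁) * (G.m₂ * (G.m₁ * (x + t) + (y - t) * (x + y)) * G.det x y +
            G.m₂ * (G.m₁ * x + y * (x + y)) * G.det (x + t) (y - t)))) := by
  unfold marginal totalPower det; ring

theorem indirect_le_det (hx' : x ≤ G.m₁) (hy : 0 ≤ y) (hy' : y ≤ G.m₂) :
    G.m₁ * x + y * (x + y) ≤ G.det x y := by
  have h1 : G.det x y - (G.m₁ * x + y * (x + y)) =
      (G.m₁ * G.m₂ - x * y) + y * (G.m₂ - y) := by unfold det; ring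
  have hxy : x * y ≤ G.m₁ * G.m₂ := mul_le_mul hx' hy' hy G.m₁_pos.le
  have h2 : 0 ≤ y * (G.m₂ - y) := mul_nonneg hy (sub_nonneg.2 hy')
  linarith

/-- The shift keeps `x + y`, hence `M`, fixed. Dividing the marginal by `det ^ 2` leaves a
difference with factor `t`, whose cofactor is shown to be negative. -/
theorem marginal_shift_lt {t : ℝ} (hx : 0 ≤ x) (ht : 0 < t) (hxt : x + t ≤ G.m₁)
    (hty : t ≤ y) (hy : y ≤ G.m₂) :
    G.marginal (x + t) (y - t) * G.det x y ^ 2 <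
      G.marginal x y * G.det (x + t) (y - t) ^ 2 := by
  have ha := G.m₁_pos
  have hb := G.m₂_pos
  have hq : 0 < 1 - G.p := sub_pos.2 G.p_lt_one
  have hD0 := G.det_pos hx (ht.le.trans hty)
  have hDt := G.det_pos (x := x + t) (y := y - t) (by linarith) (by linarith)
  have hW0 := G.indirect_le_det (x := x) (y := y) (by linarith) (ht.le.trans hty) hy
  have hWt := G.indirect_le_det (x := x + t) (y := y - t) hxt (by linarith)
    (by linarith)
  rw [show x + t + (y - t) = x + y by ring] at hWt
  have hy0 : 0 ≤ y := ht.le.trans hty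
  have hyt : 0 ≤ y - t := by linarith
  have hW0' : 0 ≤ G.m₁ * x + y * (x + y) := by positivity
  have hWt' : 0 ≤ G.m₁ * (x + t) + (y - t) * (x + y) := by positivity
  have hM := G.totalPower_lower (x := x) (y := y)
  have hS : 0 < G.m₁ + G.m₂ - (x + y) := by linarith
  have key := G.marginal_shift_identity x y t
  set D0 := G.det x y
  set Dt := G.det (x + t) (y - t)
  set W0 := G.m₁ * x + y * (x + y)
  set Wt := G.m₁ * (x + t) + (y - t) * (x + y)
  set M := G.totalPower x y
  set σ := x + y
  -- the coefficient `κ` bounds the growth of the second summand from below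
  obtain ⟨κ, hκ0, hκ, hB⟩ : ∃ κ : ℝ, 0 ≤ κ ∧
      G.m₁ * G.m₂ - σ ^ 2 < κ * (G.m₁ + G.m₂ - σ) ∧
      G.m₂ * κ * (D0 * Dt) ≤ 2 * G.m₁ * G.m₂ * D0 * Dt +
        (G.m₂ - G.m₁) * (G.m₂ * Wt * D0 + G.m₂ * W0 * Dt) := by
    -- Take `κ = 2c` with `c = min m₁ m₂`. The strict bound holds since the difference of its sides
    -- is `(σ - c)² + c² + m₁ m₂`. When `m₂ ≤ m₁`, the last bound uses `W0 ≤ D0` and `Wt ≤ Dt`.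
    rcases le_total G.m₁ G.m₂ with h | h
    · refine ⟨2 * G.m₁, by positivity, by nlinarith [sq_nonneg (σ - G.m₁)], ?_⟩
      have : 0 ≤ (G.m₂ - G.m₁) * (G.m₂ * Wt * D0 + G.m₂ * W0 * Dt) :=
        mul_nonneg (by linarith) (by positivity)
      linarith
    · refine ⟨2 * G.m₂, by positivity, by nlinarith [sq_nonneg (σ - G.m₂)], ?_⟩
      have h1 : Wt * D0 + W0 * Dt ≤ 2 * (D0 * Dt) := by nlinarith
      have h2 := mul_le_mul_of_nonneg_left h1 (mul_nonneg hb.le (sub_nonneg.2 h))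
      linarith
  have hDD : 0 < D0 * Dt := mul_pos hD0 hDt
  have hM0 : 0 < M := (mul_pos hq hS).trans_le hM
  have h1 := mul_le_mul_of_nonneg_left hB hM0.le
  have h2 := mul_le_mul_of_nonneg_right hM
    (mul_nonneg (mul_nonneg hb.le hκ0) hDD.le)
  have h3 := mul_lt_mul_of_pos_right hκ (mul_pos (mul_pos hq hb) hDD)
  have h4 : (1 - G.p) * G.m₂ * (G.m₁ * G.m₂ - σ ^ 2) * D0 * Dt -
      M * (2 * G.m₁ * G.m₂ * D0 * Dt +
        (G.m₂ - G.m₁) * (G.m₂ * Wt * D0 + G.m₂ * W0 * Dt)) < 0 := by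
    linarith
  have := mul_neg_of_pos_of_neg ht h4
  linarith

theorem marginal_zero_pos : 0 < G.marginal 0 0 := by
  have ha := G.m₁_pos
  have hb := G.m₂_pos
  have : G.marginal 0 0 = (G.m₁ * G.m₂) ^ 2 := by unfold marginal det; ring
  rw [this]; positivity

/-- Supplies the right endpoint of the existence argument. Equality holds only for `p = 0`, `m = m₁
+ m₂`, `y = m₂`, so in that game `(m₁, m₂)` is a spurious critical point. -/
theorem marginal_max_nonpos (hy : y ∈ Set.Icc 0 G.m₂) : G.marginal G.m₁ y ≤ 0 := by
  obtain ⟨hy0, hy1⟩ := hy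
  have ha := G.m₁_pos
  have hb := G.m₂_pos
  have hp := G.p_nonneg
  have hq : 0 < 1 - G.p := sub_pos.2 G.p_lt_one
  have h1 : G.marginal G.m₁ y =
      -(G.p * (G.m₁ * G.m₂ * (G.m₁ ^ 2 + G.m₁ * G.m₂ + y ^ 2)) +
        (1 - G.p) * (G.m₂ - y) * (G.m₂ * (G.m₁ ^ 2 + G.m₁ * y + y ^ 2)) +
        (G.m - G.m₁ - G.m₂) *
          (G.m₁ ^ 3 + 2 * G.m₂ * (G.m₁ + y) * G.m₁ + G.m₂ * y ^ 2)) := by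
    unfold marginal det totalPower; ring
  have h2 : 0 ≤ G.m₂ - y := by linarith
  have h3 : 0 ≤ G.m - G.m₁ - G.m₂ := by linarith [G.add_le]
  rw [h1]
  have : 0 ≤ G.p * (G.m₁ * G.m₂ * (G.m₁ ^ 2 + G.m₁ * G.m₂ + y ^ 2)) +
        (1 - G.p) * (G.m₂ - y) * (G.m₂ * (G.m₁ ^ 2 + G.m₁ * y + y ^ 2)) +
        (G.m - G.m₁ - G.m₂) *
          (G.m₁ ^ 3 + 2 * G.m₂ * (G.m₁ + y) * G.m₁ + G.m₂ * y ^ 2) := by positivity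
  linarith

/-- Against a pool that does not infiltrate, it never pays to use more than half the power. -/
theorem le_half_of_marginal_nonneg (hx : 0 ≤ x) (h : 0 ≤ G.marginal x 0) : x ≤ G.m₁ / 2 := by
  have ha := G.m₁_pos
  have hb := G.m₂_pos
  have hp := G.p_nonneg
  have h1 : G.marginal x 0 =
      G.m₁ * (G.m₂ * (G.m₁ * G.m₂ - 2 * G.m₂ * x - G.p * x ^ 2) -
        (G.m - G.m₁ - G.m₂) * (x ^ 2 + 2 * G.m₂ * x)) := by
    unfold marginal det totalPower; ring
  rw [h1] at h
  have h2 := nonneg_of_mul_nonneg_right h ha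
  have h3 : 0 ≤ (G.m - G.m₁ - G.m₂) * (x ^ 2 + 2 * G.m₂ * x) :=
    mul_nonneg (by linarith [G.add_le]) (by positivity)
  have h4 : 0 ≤ G.m₁ * G.m₂ - 2 * G.m₂ * x - G.p * x ^ 2 :=
    nonneg_of_mul_nonneg_right (by linarith) hb
  have h5 : 0 ≤ G.p * x ^ 2 := by positivity
  nlinarith

end estimates

/-! ### Equilibria as critical points -/

section critical

variable (G : MinersDilemma) {x y : ℝ}

/-- The numerator of `reward₁`. -/
def numer (G : MinersDilemma) (x y : ℝ) : ℝ :=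
  G.m₁ * G.m₂ + G.m₁ * x + G.p * G.m₂ * y - (1 - G.p) * x ^ 2 - (1 - G.p) * x * y

theorem reward₁_eq (x y : ℝ) :
    G.reward₁ x y = G.numer x y / (G.totalPower x y * G.det x y) := rfl

theorem numer_nonneg (hx : x ∈ Set.Icc 0 G.m₁) (hy : y ∈ Set.Icc 0 G.m₂) : 0 ≤ G.numer x y := by
  obtain ⟨hx0, hx1⟩ := hx
  obtain ⟨hy0, hy1⟩ := hy
  have ha := G.m₁_pos
  have hb := G.m₂_pos
  have hp := G.p_nonneg
  have hq : 0 < 1 - G.p := sub_pos.2 G.p_lt_one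
  have h1 : G.numer x y = G.p * (G.m₁ * G.m₂ + G.m₁ * x + G.m₂ * y) +
      (1 - G.p) * ((G.m₁ - x) * (G.m₂ + x) + x * (G.m₂ - y)) := by
    unfold numer; ring
  have h2 : 0 ≤ G.m₁ - x := by linarith
  have h3 : 0 ≤ G.m₂ - y := by linarith
  rw [h1]; positivity

/-- An exact expansion of the cross-multiplied comparison of two rewards: the linear term carries
the marginal, and the quadratic term has a definite sign by `descent_pos`. It yields both directions
of the first-order criterion. -/
theorem numer_cross (x x' y : ℝ) :
    G.numer x' y * (G.totalPower x y * G.det x y) -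
      G.numer x y * (G.totalPower x' y * G.det x' y) =
    (1 - G.p) * ((x' - x) * G.marginal x y - (x' - x) ^ 2 * G.descent x y) := by
  unfold numer marginal descent totalPower det; ring

theorem IsCritical.isMaxOn (h : G.IsCritical x y) (hy : y ∈ Set.Icc 0 G.m₂)
    (hM : 0 < G.totalPower x y) : IsMaxOn (fun e => G.reward₁ e y) (Set.Icc 0 G.m₁) x := by
  intro e he
  obtain ⟨hx, h⟩ := h
  have hq : 0 < 1 - G.p := sub_pos.2 G.p_lt_one
  have hD := G.det_pos hx.1 hy.1
  have hDe := G.det_pos he.1 hy.1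
  simp only [Set.mem_ofPred_eq, reward₁_eq]
  rcases (G.totalPower_nonneg he.2 hy.2).eq_or_lt with h0 | h0
  · rw [← h0, zero_mul, div_zero]
    exact div_nonneg (G.numer_nonneg hx hy) (by positivity)
  · rw [div_le_div_iff₀ (by positivity) (by positivity)]
    have h1 := G.numer_cross x e y
    have h2 := h e he
    have h3 := mul_nonneg (sq_nonneg (e - x)) (G.descent_pos hx hy hM).le
    nlinarith

theorem isCritical_of_isMaxOn (hx : x ∈ Set.Icc 0 G.m₁) (hy : y ∈ Set.Icc 0 G.m₂)
    (hM : 0 < G.totalPower x y)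
    (h : IsMaxOn (fun e => G.reward₁ e y) (Set.Icc 0 G.m₁) x) : G.IsCritical x y := by
  refine ⟨hx, fun e he => ?_⟩
  have hq : 0 < 1 - G.p := sub_pos.2 G.p_lt_one
  have hD := G.det_pos hx.1 hy.1
  -- Compare `x` with points of the segment towards `e` and let `t` tend to `0`. Excluding `t = 1`
  -- keeps the total power positive even if it vanishes at `e`.
  have hstep : ∀ t ∈ Set.Ioo (0 : ℝ) 1,
      (e - x) * G.marginal x y ≤ t * ((e - x) ^ 2 * G.descent x y) := by
    rintro t ⟨ht0, ht1⟩
    have hmem : x + t * (e - x) ∈ Set.Icc 0 G.m₁ := by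
      constructor
      · nlinarith [hx.1, he.1, mul_nonneg ht0.le he.1, mul_nonneg (sub_nonneg.2 ht1.le) hx.1]
      · nlinarith [hx.2, he.2, mul_le_mul_of_nonneg_left he.2 ht0.le,
          mul_le_mul_of_nonneg_left hx.2 (sub_nonneg.2 ht1.le)]
    have hMt : 0 < G.totalPower (x + t * (e - x)) y := by
      have h1 : G.totalPower (x + t * (e - x)) y =
          (1 - t) * G.totalPower x y + t * G.totalPower e y := by unfold totalPower; ring
      rw [h1]
      exact add_pos_of_pos_of_nonneg (mul_pos (sub_pos.2 ht1) hM)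
        (mul_nonneg ht0.le (G.totalPower_nonneg he.2 hy.2))
    have hDt := G.det_pos hmem.1 hy.1
    have h1 := h hmem
    simp only [Set.mem_ofPred_eq, reward₁_eq] at h1
    rw [div_le_div_iff₀ (by positivity) (by positivity)] at h1
    have h2 := G.numer_cross x (x + t * (e - x)) y
    rw [show x + t * (e - x) - x = t * (e - x) by ring] at h2
    have h3 : (1 - G.p) * t * ((e - x) * G.marginal x y -
        t * ((e - x) ^ 2 * G.descent x y)) ≤ 0 := by linarith
    by_contra hcon
    have := mul_pos (mul_pos hq ht0) (sub_pos.2 (not_le.1 hcon))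
    linarith
  have hlim : Filter.Tendsto (fun t : ℝ => t * ((e - x) ^ 2 * G.descent x y))
      (nhdsWithin 0 (Set.Ioi 0)) (nhds 0) := by
    have : Filter.Tendsto (fun t : ℝ => t * ((e - x) ^ 2 * G.descent x y)) (nhds 0)
        (nhds (0 * ((e - x) ^ 2 * G.descent x y))) := by
      exact (continuous_id.mul continuous_const).tendsto 0
    rw [zero_mul] at this
    exact this.mono_left nhdsWithin_le_nhds
  refine ge_of_tendsto hlim ?_
  filter_upwards [Ioo_mem_nhdsGT (zero_lt_one (α := ℝ))] with t ht using hstep t ht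

theorem IsPureNash.totalPower_pos {x : ℝ × ℝ} (h : G.IsPureNash x) :
    0 < G.totalPower x.1 x.2 := by
  obtain ⟨⟨hx, hy⟩, h1, -⟩ := h
  -- At zero total power the reward is `0` by division by zero, whereas withdrawing all infiltration
  -- earns pool 1 a positive reward.
  refine lt_of_le_of_ne (G.totalPower_nonneg hx.2 hy.2) fun h0 => ?_
  have ha := G.m₁_pos
  have hb := G.m₂_pos
  have hp := G.p_nonneg
  have h2 := h1 (Set.left_mem_Icc.2 ha.le)
  simp only [Set.mem_ofPred_eq, reward₁_eq] at h2
  rw [← h0, zero_mul, div_zero] at h2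
  have hM := G.totalPower_pos_of_lt ha hy.2
  have hD := G.det_pos le_rfl hy.1
  have hN : 0 < G.numer 0 x.2 := by
    have := hy.1
    have h3 : G.numer 0 x.2 = G.m₁ * G.m₂ + G.p * G.m₂ * x.2 := by unfold numer; ring
    rw [h3]; positivity
  exact absurd h2 (not_le.2 (by positivity))

/-- Equilibria are the solutions of the first-order conditions with positive total power. -/
theorem isPureNash_iff (x : ℝ × ℝ) :
    G.IsPureNash x ↔
      G.IsCritical x.1 x.2 ∧ G.swap.IsCritical x.2 x.1 ∧ 0 < G.totalPower x.1 x.2 := by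
  constructor
  · intro h
    have hM := IsPureNash.totalPower_pos G h
    have h' := h.swap
    exact ⟨G.isCritical_of_isMaxOn h.1.1 h.1.2 hM h.2.1,
      G.swap.isCritical_of_isMaxOn h'.1.1 h'.1.2 (by rwa [totalPower_swap]) h'.2.1, hM⟩
  · rintro ⟨h1, h2, hM⟩
    refine ⟨⟨h1.1, h2.1⟩, IsCritical.isMaxOn G h1 h2.1 hM, ?_⟩
    have := IsCritical.isMaxOn G.swap h2 h1.1 (by rwa [totalPower_swap])
    simp only [reward₁_swap] at this
    exact this

variable {G}

theorem IsCritical.marginal_nonneg (h : G.IsCritical x y) (hx : 0 < x) : 0 ≤ G.marginal x y := by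
  have := h.2 0 (Set.left_mem_Icc.2 G.m₁_pos.le)
  nlinarith

theorem IsCritical.marginal_nonpos (h : G.IsCritical x y) (hx : x < G.m₁) :
    G.marginal x y ≤ 0 := by
  have := h.2 G.m₁ (Set.right_mem_Icc.2 G.m₁_pos.le)
  nlinarith

theorem IsCritical.eq_of_eq {x' : ℝ} (h : G.IsCritical x y) (h' : G.IsCritical x' y)
    (hy : y ∈ Set.Icc 0 G.m₂) (hM : 0 < G.totalPower x y) (hM' : 0 < G.totalPower x' y) :
    x = x' := by
  rcases lt_trichotomy x x' with hlt | heq | hlt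
  · have h1 := G.marginal_lt h.1.1 hlt h'.1.2 hy hM'
    have h2 := h.marginal_nonpos (hlt.trans_le h'.1.2)
    have h3 := h'.marginal_nonneg (h.1.1.trans_lt hlt)
    linarith
  · exact heq
  · have h1 := G.marginal_lt h'.1.1 hlt h.1.2 hy hM
    have h2 := h'.marginal_nonpos (hlt.trans_le h.1.2)
    have h3 := h.marginal_nonneg (h'.1.1.trans_lt hlt)
    linarith

end critical

/-! ### Uniqueness of the equilibrium -/

section uniqueness

variable {G : MinersDilemma} {x y x' y' : ℝ}

/-- Two equilibria cannot be comparable in both coordinates. -/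
theorem not_lt_lt_of_isCritical (h₁ : G.IsCritical x y) (h₂ : G.swap.IsCritical y x)
    (h₁' : G.IsCritical x' y') (h₂' : G.swap.IsCritical y' x')
    (hM' : 0 < G.totalPower x' y') (hx : x < x') : ¬ y < y' := by
  intro hy
  have ha := G.m₁_pos
  have hb := G.m₂_pos
  have hm : 0 ≤ G.m - G.m₁ - G.m₂ := by linarith [G.add_le]
  have hq : 0 < 1 - G.p := sub_pos.2 G.p_lt_one
  have hx0 := h₁.1.1
  have hy0 := h₂.1.1
  have k1 := h₁.marginal_nonpos (hx.trans_le h₁'.1.2)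
  have k2 := h₂.marginal_nonpos (hy.trans_le h₂'.1.2)
  have k1' := h₁'.marginal_nonneg (hx0.trans_lt hx)
  have k2' := h₂'.marginal_nonneg (hy0.trans_lt hy)
  have e := G.weighted_marginal_sum x y
  have e' := G.weighted_marginal_sum x' y'
  have hD := G.det_pos hx0 hy0
  have hDD : G.det x y ^ 2 ≤ G.det x' y' ^ 2 := by
    refine pow_le_pow_left₀ hD.le ?_ 2
    unfold det; nlinarith
  have hMM : G.totalPower x' y' ≤ G.totalPower x y := by
    unfold totalPower; nlinarith
  have hσ : (x + y) ^ 2 < (x' + y') ^ 2 := by nlinarith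
  -- The weighted sum is nonpositive at the smaller profile and nonnegative at the larger. But going
  -- up, `M` falls while `D` and `σ` grow, so it should strictly decrease.
  have hK : G.m₁ * G.marginal x y + G.m₂ * G.swap.marginal y x ≤ 0 := by nlinarith
  have hK' : 0 ≤ G.m₁ * G.marginal x' y' + G.m₂ * G.swap.marginal y' x' := by positivity
  rw [e] at hK
  rw [e'] at hK'
  have hm2 := mul_le_mul_of_nonneg_left hDD hm
  -- Multiplying by the larger `M` preserves the comparison only for a nonnegative factor, which
  -- `hK'` provides.
  have hc' : 0 ≤ G.m₁ * G.m₂ * (G.m₁ * G.m₂ - (x' + y') ^ 2) := by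
    have : 0 ≤ (G.m - G.m₁ - G.m₂) * G.det x' y' ^ 2 := by positivity
    exact nonneg_of_mul_nonneg_right (by linarith) hM'
  have hcc : G.m₁ * G.m₂ * (G.m₁ * G.m₂ - (x' + y') ^ 2) <
      G.m₁ * G.m₂ * (G.m₁ * G.m₂ - (x + y) ^ 2) :=
    mul_lt_mul_of_pos_left (by linarith) (by positivity)
  have h3 := mul_lt_mul_of_pos_left hcc hM'
  have h4 := mul_le_mul_of_nonneg_right hMM (hc'.trans hcc.le)
  linarith

/-- Moving power from `y` to `x` and then more of it to `x` decreases the marginal reward. -/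
theorem marginal_neg_of_shift (hx0 : 0 ≤ x) (hx' : x' ≤ G.m₁) (hy0 : 0 ≤ y')
    (hy : y' < y) (hy1 : y ≤ G.m₂) (hs : x + y ≤ x' + y') (h : G.marginal x y ≤ 0) :
    G.marginal x' y' < 0 := by
  have hlt := G.marginal_shift_lt hx0 (sub_pos.2 hy) (by linarith) (by linarith) hy1
  rw [show y - (y - y') = y' by ring] at hlt
  have hD := G.det_pos hx0 (hy0.trans hy.le)
  have hmid : G.marginal (x + (y - y')) y' < 0 := by
    have h1 := mul_nonpos_of_nonpos_of_nonneg h (sq_nonneg (G.det (x + (y - y')) y'))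
    exact neg_of_mul_neg_left (hlt.trans_le h1) (sq_nonneg _)
  rcases hs.lt_or_eq with hs | hs
  · exact (G.marginal_lt (by linarith) (by linarith) hx' ⟨hy0, by linarith⟩
      (G.swap.totalPower_pos_of_lt (x := y') (y := x') (by exact hy.trans_le hy1) hx' |>.trans_eq
        (G.totalPower_swap x' y'))).trans hmid
  · rwa [show x' = x + (y - y') by linarith]

theorem not_lt_gt_of_isCritical (h₁ : G.IsCritical x y) (h₂ : G.swap.IsCritical y x)
    (h₁' : G.IsCritical x' y') (h₂' : G.swap.IsCritical y' x') (hx : x < x') : ¬ y' < y := by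
  intro hy
  have k1 := h₁.marginal_nonpos (hx.trans_le h₁'.1.2)
  have k2 := h₂'.marginal_nonpos (hy.trans_le h₂.1.2)
  have k1' := h₁'.marginal_nonneg (h₁.1.1.trans_lt hx)
  have k2' := h₂.marginal_nonneg (h₂'.1.1.trans_lt hy)
  -- Start from the profile with the smaller sum, applying the shift to the pool that infiltrates
  -- more at the other profile.
  rcases le_total (x + y) (x' + y') with hs | hs
  · exact absurd (marginal_neg_of_shift h₁.1.1 h₁'.1.2 h₂'.1.1 hy h₂.1.2 hs k1) (not_lt.2 k1')
  · exact absurd (marginal_neg_of_shift (G := G.swap) h₂'.1.1 h₂.1.2 h₁.1.1 hx h₁'.1.2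
      (by linarith) k2) (not_lt.2 k2')

theorem IsPureNash.fst_le {u v : ℝ × ℝ} (hu : G.IsPureNash u) (hv : G.IsPureNash v) :
    v.1 ≤ u.1 := by
  obtain ⟨hu1, hu2, hu3⟩ := (G.isPureNash_iff u).1 hu
  obtain ⟨hv1, hv2, hv3⟩ := (G.isPureNash_iff v).1 hv
  by_contra! hlt
  rcases lt_trichotomy u.2 v.2 with h | h | h
  · exact not_lt_lt_of_isCritical hu1 hu2 hv1 hv2 hv3 hlt h
  · rw [← h] at hv1 hv3
    exact hlt.ne (hu1.eq_of_eq hv1 hu2.1 hu3 hv3)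
  · exact not_lt_gt_of_isCritical hu1 hu2 hv1 hv2 hlt h

theorem IsPureNash.unique {u v : ℝ × ℝ} (hu : G.IsPureNash u) (hv : G.IsPureNash v) : u = v :=
  Prod.ext (le_antisymm (hv.fst_le hu) (hu.fst_le hv))
    (le_antisymm (hv.swap.fst_le hu.swap) (hu.swap.fst_le hv.swap))

end uniqueness

/-! ### Bounds on total infiltration -/

section welfareBound

variable {G : MinersDilemma}

theorem IsPureNash.infiltration_pos {u : ℝ × ℝ} (hu : G.IsPureNash u) : 0 < u.1 + u.2 := by
  obtain ⟨h1, h2, -⟩ := (G.isPureNash_iff u).1 hu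
  refine lt_of_le_of_ne (add_nonneg h1.1.1 h2.1.1) fun h0 => ?_
  have hx : u.1 = 0 := by linarith [h1.1.1, h2.1.1]
  have hy : u.2 = 0 := by linarith [h1.1.1, h2.1.1]
  have := h1.marginal_nonpos (by rw [hx]; exact G.m₁_pos)
  rw [hx, hy] at this
  exact absurd G.marginal_zero_pos (not_lt.2 this)

/-- In an equilibrium in which both pools infiltrate, the total infiltration is at most the
geometric mean of the two pools' powers. -/
theorem IsPureNash.sq_infiltration_le {u : ℝ × ℝ} (hu : G.IsPureNash u) (hx : 0 < u.1)
    (hy : 0 < u.2) :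
    (G.m - G.m₁ - G.m₂) * G.det u.1 u.2 ^ 2 ≤
      G.totalPower u.1 u.2 * (G.m₁ * G.m₂ * (G.m₁ * G.m₂ - (u.1 + u.2) ^ 2)) ∧
      (u.1 + u.2) ^ 2 ≤ G.m₁ * G.m₂ := by
  obtain ⟨h1, h2, hM⟩ := (G.isPureNash_iff u).1 hu
  have ha := G.m₁_pos
  have hb := G.m₂_pos
  have k1 := h1.marginal_nonneg hx
  have k2 := h2.marginal_nonneg hy
  have e := G.weighted_marginal_sum u.1 u.2
  have hm : 0 ≤ G.m - G.m₁ - G.m₂ := by linarith [G.add_le]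
  have hK : 0 ≤ G.m₁ * G.marginal u.1 u.2 + G.m₂ * G.swap.marginal u.2 u.1 := by positivity
  have h3 : 0 ≤ (G.m - G.m₁ - G.m₂) * G.det u.1 u.2 ^ 2 := by positivity
  refine ⟨by linarith, ?_⟩
  have h4 : 0 ≤ G.m₁ * G.m₂ * (G.m₁ * G.m₂ - (u.1 + u.2) ^ 2) :=
    nonneg_of_mul_nonneg_right (by linarith) hM
  have := nonneg_of_mul_nonneg_right h4 (mul_pos ha hb)
  linarith

theorem IsPureNash.infiltration_lt_of_fst_eq_zero {u : ℝ × ℝ} (hu : G.IsPureNash u)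
    (hx : u.1 = 0) : u.1 + u.2 < (G.m₁ + G.m₂) / 2 := by
  obtain ⟨-, h2, -⟩ := (G.isPureNash_iff u).1 hu
  have hpos := hu.infiltration_pos
  rw [hx, zero_add] at hpos ⊢
  rw [hx] at h2
  have := G.swap.le_half_of_marginal_nonneg hpos.le (h2.marginal_nonneg hpos)
  have ha := G.m₁_pos
  simp only [MinersDilemma.swap] at this
  linarith

theorem IsPureNash.infiltration_le {u : ℝ × ℝ} (hu : G.IsPureNash u) :
    u.1 + u.2 ≤ (G.m₁ + G.m₂) / 2 ∧
      (u.1 + u.2 = (G.m₁ + G.m₂) / 2 → G.m₁ = G.m / 2 ∧ G.m₂ = G.m / 2) := by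
  have ha := G.m₁_pos
  have hb := G.m₂_pos
  rcases hu.1.1.1.eq_or_lt with hx | hx
  · have := hu.infiltration_lt_of_fst_eq_zero hx.symm
    exact ⟨this.le, fun h => absurd h this.ne⟩
  rcases hu.1.2.1.eq_or_lt with hy | hy
  · have := hu.swap.infiltration_lt_of_fst_eq_zero hy.symm
    simp only [MinersDilemma.swap] at this
    exact ⟨by linarith, fun h => absurd h (by linarith [this] : u.1 + u.2 < _).ne⟩
  obtain ⟨h1, h2⟩ := hu.sq_infiltration_le hx hy
  constructor
  · nlinarith [sq_nonneg (G.m₁ - G.m₂)]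
  · intro h
    have h3 : (G.m₁ - G.m₂) ^ 2 ≤ 0 := by
      rw [h] at h2; nlinarith
    have h4 : G.m₁ = G.m₂ := by
      have := pow_eq_zero_iff (two_ne_zero) |>.1 (le_antisymm h3 (sq_nonneg _))
      linarith
    -- Equality in AM-GM leaves `(m - m₁ - m₂) D² ≤ 0`, so no power remains outside the pools.
    have h5 : G.m₁ * G.m₂ - (u.1 + u.2) ^ 2 = 0 := by rw [h, h4]; ring
    rw [h5, mul_zero, mul_zero] at h1
    have hD := G.det_pos hx.le hy.le
    have h6 : G.m - G.m₁ - G.m₂ ≤ 0 := by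
      by_contra! hc
      exact absurd h1 (not_le.2 (by positivity))
    have := G.add_le
    constructor <;> linarith

end welfareBound

/-! ### Existence of an equilibrium -/

section existence

variable (G : MinersDilemma)

theorem continuous_marginal : Continuous fun z : ℝ × ℝ => G.marginal z.1 z.2 := by
  unfold marginal totalPower det; fun_prop

theorem exists_isCritical (y : ℝ) : ∃ x, G.IsCritical x y := by
  have ha := G.m₁_pos
  have hc : Continuous fun x => G.marginal x y := by
    unfold marginal totalPower det; fun_prop
  by_cases h0 : G.marginal 0 y ≤ 0
  · refine ⟨0, Set.left_mem_Icc.2 ha.le, fun e he => ?_⟩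
    exact mul_nonpos_of_nonneg_of_nonpos (by linarith [he.1]) h0
  by_cases h1 : 0 ≤ G.marginal G.m₁ y
  · refine ⟨G.m₁, Set.right_mem_Icc.2 ha.le, fun e he => ?_⟩
    exact mul_nonpos_of_nonpos_of_nonneg (by linarith [he.2]) h1
  push Not at h0 h1
  obtain ⟨x, hx, hx0⟩ := intermediate_value_Icc' ha.le hc.continuousOn ⟨h1.le, h0.le⟩
  refine ⟨x, hx, fun e _ => ?_⟩
  simp only at hx0
  rw [hx0, mul_zero]

theorem isClosed_isCritical_swap :
    IsClosed {z : ℝ × ℝ | G.swap.IsCritical z.2 z.1} := by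
  have hc : Continuous fun z : ℝ × ℝ => G.swap.marginal z.2 z.1 :=
    G.swap.continuous_marginal.comp continuous_swap
  have : {z : ℝ × ℝ | G.swap.IsCritical z.2 z.1} =
      Prod.snd ⁻¹' Set.Icc 0 G.m₂ ∩
        ⋂ e ∈ Set.Icc 0 G.m₂, {z : ℝ × ℝ | (e - z.2) * G.swap.marginal z.2 z.1 ≤ 0} := by
    ext z
    simp only [Set.mem_inter_iff, Set.mem_iInter]
    exact Iff.rfl
  rw [this]
  refine (isClosed_Icc.preimage continuous_snd).inter
    (isClosed_biInter fun e _ => isClosed_le ?_ continuous_const)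
  exact (continuous_const.sub continuous_snd).mul hc

/-- Projections of compact sets are compact. This replaces continuity of the best response of pool
2. -/
theorem isClosed_projection_of_isCritical_swap (x₀ : ℝ) {S : Set (ℝ × ℝ)} (hS : IsClosed S) :
    IsClosed {x | x ∈ Set.Icc 0 x₀ ∧ ∃ y, G.swap.IsCritical y x ∧ (x, y) ∈ S} := by
  have hK : IsCompact ((Set.Icc 0 x₀ ×ˢ Set.Icc 0 G.m₂) ∩
      ({z : ℝ × ℝ | G.swap.IsCritical z.2 z.1} ∩ S)) :=
    (isCompact_Icc.prod isCompact_Icc).inter_right (G.isClosed_isCritical_swap.inter hS)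
  convert (hK.image continuous_fst).isClosed using 1
  ext x
  constructor
  · rintro ⟨hx, y, hy, hS⟩
    exact ⟨(x, y), ⟨⟨hx, hy.1⟩, hy, hS⟩, rfl⟩
  · rintro ⟨⟨x, y⟩, ⟨⟨hx, -⟩, hy, hS⟩, rfl⟩
    exact ⟨hx, y, hy, hS⟩

/-- An equilibrium exists as soon as the best response of pool 1 to the best response of pool 2
to some `x₀` is at most `x₀`. -/
theorem exists_isPureNash_of_marginal_nonpos {x₀ : ℝ} (hx₀ : x₀ ∈ Set.Icc 0 G.m₁)
    (hM : 0 < G.totalPower x₀ G.m₂)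
    (h : ∀ y, G.swap.IsCritical y x₀ → G.marginal x₀ y ≤ 0) : ∃ u, G.IsPureNash u := by
  have hMx : ∀ x y, x ∈ Set.Icc 0 x₀ → G.swap.IsCritical y x → 0 < G.totalPower x y :=
    fun x y hx hy => G.totalPower_pos_of_le hM hx.2 hy.1.2
  have hleft : (0 : ℝ) ∈ Set.Icc 0 x₀ := Set.left_mem_Icc.2 hx₀.1
  obtain ⟨y₀, hy₀⟩ := G.swap.exists_isCritical 0
  by_cases h0 : G.marginal 0 y₀ ≤ 0
  · refine ⟨(0, y₀), (G.isPureNash_iff _).2 ⟨⟨Set.left_mem_Icc.2 G.m₁_pos.le, fun e he => ?_⟩,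
      hy₀, hMx 0 y₀ hleft hy₀⟩⟩
    exact mul_nonpos_of_nonneg_of_nonpos (by simpa using he.1) h0
  -- The points where `F₁` is `≥ 0`, respectively `≤ 0`, at some best response form two closed sets
  -- covering `[0, x₀]`. They meet, and uniqueness of the best response then gives `F₁ = 0`.
  have hconn := isPreconnected_closed_iff.1 (isPreconnected_Icc (a := (0 : ℝ)) (b := x₀))
    _ _
    (G.isClosed_projection_of_isCritical_swap x₀
      (isClosed_le continuous_const G.continuous_marginal (f := fun _ => (0 : ℝ))))
    (G.isClosed_projection_of_isCritical_swap x₀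
      (isClosed_le G.continuous_marginal continuous_const (g := fun _ => (0 : ℝ))))
  obtain ⟨y₁, hy₁⟩ := G.swap.exists_isCritical x₀
  have hright : x₀ ∈ Set.Icc 0 x₀ := Set.right_mem_Icc.2 hx₀.1
  obtain ⟨x, hx, ⟨-, y, hy, h1⟩, -, y', hy', h2⟩ := hconn
    (by
      intro x hx
      obtain ⟨y, hy⟩ := G.swap.exists_isCritical x
      rcases le_total 0 (G.marginal x y) with hs | hs
      · exact Or.inl ⟨hx, y, hy, hs⟩
      · exact Or.inr ⟨hx, y, hy, hs⟩)
    ⟨0, hleft, hleft, y₀, hy₀, (not_le.1 h0).le⟩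
    ⟨x₀, hright, hright, y₁, hy₁, h y₁ hy₁⟩
  have hx1 : x ∈ Set.Icc 0 G.m₁ := ⟨hx.1, hx.2.trans hx₀.2⟩
  have hyy : y = y' := hy.eq_of_eq hy' hx1 (by rw [totalPower_swap]; exact hMx x y hx hy)
    (by rw [totalPower_swap]; exact hMx x y' hx hy')
  rw [← hyy] at h2
  have h3 : G.marginal x y = 0 := le_antisymm h2 h1
  refine ⟨(x, y), (G.isPureNash_iff _).2 ⟨⟨hx1, fun e _ => ?_⟩, hy, hMx x y hx hy⟩⟩
  simp only [h3, mul_zero, le_refl]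

theorem exists_isPureNash : ∃ u, G.IsPureNash u := by
  have ha := G.m₁_pos
  have hb := G.m₂_pos
  have hq : 0 < 1 - G.p := sub_pos.2 G.p_lt_one
  -- If total power vanishes at the corner, `x₀ = m₁` is unusable. For `x₀` just below `m₁`, pool 2
  -- answers with at least `m₂ / 2`; as also `x₀ > m₁ / 2`, AM-GM makes the weighted sum
  -- nonpositive, and `F₂ ≥ 0` gives `F₁ ≤ 0`.
  rcases (G.totalPower_nonneg (x := G.m₁) (y := G.m₂) le_rfl le_rfl).eq_or_lt with h0 | h0
  · have h0' : G.p * (G.m₁ + G.m₂) + (G.m - G.m₁ - G.m₂) = 0 := by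
      unfold totalPower at h0; linarith
    have hm : G.m = G.m₁ + G.m₂ := by
      nlinarith [G.add_le, mul_nonneg G.p_nonneg (add_pos ha hb).le]
    have hp : G.p = 0 := by
      rcases mul_eq_zero.1 (by linarith : G.p * (G.m₁ + G.m₂) = 0) with h | h
      · exact h
      · linarith
    have hc : Continuous fun x => G.swap.marginal (G.m₂ / 2) x :=
      G.swap.continuous_marginal.comp (continuous_const.prodMk continuous_id)
    have hpos : 0 < G.swap.marginal (G.m₂ / 2) G.m₁ := by
      have : G.swap.marginal (G.m₂ / 2) G.m₁ = (G.m₁ * (G.m₂ / 2)) ^ 2 := by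
        simp only [marginal, totalPower, det, swap, hm, hp]; ring
      rw [this]; positivity
    have hev : ∀ᶠ x in nhdsWithin G.m₁ (Set.Iio G.m₁), 0 < G.swap.marginal (G.m₂ / 2) x :=
      (hc.tendsto G.m₁).mono_left nhdsWithin_le_nhds |>.eventually (lt_mem_nhds hpos)
    obtain ⟨x₀, hx₀, hx₁, hx₂⟩ :=
      (hev.and (Ioo_mem_nhdsLT (half_lt_self ha))).exists
    have hM := G.totalPower_pos_of_lt hx₂ (le_refl G.m₂)
    refine G.exists_isPureNash_of_marginal_nonpos ⟨by linarith, hx₂.le⟩ hM fun y hy => ?_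
    have hMy : 0 < G.totalPower x₀ y := G.totalPower_pos_of_le hM le_rfl hy.1.2
    have hy2 : G.m₂ / 2 ≤ y := by
      by_contra! hlt
      have h1 := G.swap.marginal_lt hy.1.1 hlt (half_le_self hb.le)
        (y := x₀) ⟨by linarith, hx₂.le⟩
        (by rw [totalPower_swap]; exact G.totalPower_pos_of_le hM le_rfl (half_le_self hb.le))
      have h2 := hy.marginal_nonpos (hlt.trans (half_lt_self hb))
      linarith
    have hpy := hy.marginal_nonneg (lt_of_lt_of_le (half_pos hb) hy2)
    have e := G.weighted_marginal_sum x₀ y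
    rw [show G.m - G.m₁ - G.m₂ = 0 by linarith, zero_mul, sub_zero] at e
    have hσ : G.m₁ * G.m₂ - (x₀ + y) ^ 2 ≤ 0 := by
      have : (G.m₁ + G.m₂) / 2 ≤ x₀ + y := by linarith
      nlinarith [sq_nonneg (G.m₁ - G.m₂)]
    have h3 : G.totalPower x₀ y * (G.m₁ * G.m₂ * (G.m₁ * G.m₂ - (x₀ + y) ^ 2)) ≤ 0 :=
      mul_nonpos_of_nonneg_of_nonpos hMy.le
        (mul_nonpos_of_nonneg_of_nonpos (by positivity) hσ)
    have h4 := mul_nonneg hb.le hpy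
    by_contra! hcon
    have := mul_pos ha hcon
    linarith
  · exact G.exists_isPureNash_of_marginal_nonpos (Set.right_mem_Icc.2 ha.le) h0
      fun y hy => G.marginal_max_nonpos hy.1

theorem existsUnique_isPureNash : ∃! u, G.IsPureNash u := by
  obtain ⟨u, hu⟩ := G.exists_isPureNash
  exact ⟨u, hu, fun v hv => hv.unique hu⟩

end existence

/-! ### The price of anarchy and its range -/

section priceOfAnarchy

variable (G : MinersDilemma)

theorem welfare_eq (x : ℝ × ℝ) :
    G.welfare x = G.m₁ + G.m₂ - (1 - G.p) * (x.1 + x.2) := by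
  unfold welfare power₁ power₂; ring

theorem isGreatest_welfare : IsGreatest (G.welfare '' G.profiles) (G.m₁ + G.m₂) := by
  constructor
  · refine ⟨(0, 0), ⟨Set.left_mem_Icc.2 G.m₁_pos.le, Set.left_mem_Icc.2 G.m₂_pos.le⟩, ?_⟩
    rw [welfare_eq]; simp
  · rintro _ ⟨x, hx, rfl⟩
    rw [welfare_eq]
    have := mul_nonneg (sub_pos.2 G.p_lt_one).le (add_nonneg hx.1.1 hx.2.1)
    linarith

variable {G}

theorem IsPureNash.PPoA_eq {u : ℝ × ℝ} (hu : G.IsPureNash u) :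
    G.PPoA = (G.m₁ + G.m₂) / (G.m₁ + G.m₂ - (1 - G.p) * (u.1 + u.2)) := by
  have : {x | G.IsPureNash x} = {u} := by
    ext v
    exact ⟨fun hv => IsPureNash.unique hv hu, fun hv => by rw [Set.mem_singleton_iff.1 hv]; exact hu⟩
  rw [PPoA, G.isGreatest_welfare.csSup_eq, this, Set.image_singleton, csInf_singleton, welfare_eq]

theorem IsPureNash.welfare_bound {u : ℝ × ℝ} (hu : G.IsPureNash u) :
    (1 + G.p) / 2 * (G.m₁ + G.m₂) ≤ G.m₁ + G.m₂ - (1 - G.p) * (u.1 + u.2) := by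
  have := mul_le_mul_of_nonneg_left hu.infiltration_le.1 (sub_pos.2 G.p_lt_one).le
  linarith

variable (G)

theorem one_lt_PPoA : 1 < G.PPoA := by
  obtain ⟨u, hu⟩ := G.exists_isPureNash
  have hS := add_pos G.m₁_pos G.m₂_pos
  have hp := G.p_nonneg
  have hpos : 0 < (1 + G.p) / 2 * (G.m₁ + G.m₂) := by positivity
  have := mul_pos (sub_pos.2 G.p_lt_one) hu.infiltration_pos
  rw [hu.PPoA_eq, one_lt_div (hpos.trans_le hu.welfare_bound)]
  linarith

theorem PPoA_le : G.PPoA ≤ 2 / (1 + G.p) := by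
  obtain ⟨u, hu⟩ := G.exists_isPureNash
  have hS := add_pos G.m₁_pos G.m₂_pos
  have hp := G.p_nonneg
  have hpos : 0 < (1 + G.p) / 2 * (G.m₁ + G.m₂) := by positivity
  rw [hu.PPoA_eq, div_le_div_iff₀ (hpos.trans_le hu.welfare_bound) (by linarith)]
  linarith [hu.welfare_bound]

theorem two_div_le_two : 2 / (1 + G.p) ≤ 2 := by
  have hp := G.p_nonneg
  rw [div_le_iff₀ (by linarith)]
  linarith

variable {G}

/-- If two equal pools own all the mining power, each of them infiltrates with half its power. -/
theorem isPureNash_half (h₁ : G.m₁ = G.m / 2) (h₂ : G.m₂ = G.m / 2) :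
    G.IsPureNash (G.m₁ / 2, G.m₂ / 2) := by
  have ha := G.m₁_pos
  have hb := G.m₂_pos
  have hm1 : G.marginal (G.m₁ / 2) (G.m₂ / 2) = 0 := by
    unfold marginal totalPower det; rw [h₁, h₂]; ring
  have hm2 : G.swap.marginal (G.m₂ / 2) (G.m₁ / 2) = 0 := by
    simp only [marginal, totalPower, det, swap]; rw [h₁, h₂]; ring
  refine (G.isPureNash_iff _).2 ⟨⟨⟨by positivity, half_le_self ha.le⟩, fun e _ => ?_⟩,
    ⟨⟨by positivity, half_le_self hb.le⟩, fun e _ => ?_⟩,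
    G.totalPower_pos_of_lt (half_lt_self ha) (half_le_self hb.le)⟩
  · simp only [hm1, mul_zero, le_refl]
  · simp only [hm2, mul_zero, le_refl]

theorem PPoA_eq_of_eq_half (h₁ : G.m₁ = G.m / 2) (h₂ : G.m₂ = G.m / 2) :
    G.PPoA = 2 / (1 + G.p) := by
  have ha := G.m₁_pos
  have hp := G.p_nonneg
  have h3 : G.m₂ = G.m₁ := by rw [h₁, h₂]
  rw [(isPureNash_half h₁ h₂).PPoA_eq, h3,
    show G.m₁ + G.m₁ - (1 - G.p) * (G.m₁ / 2 + G.m₁ / 2) = (1 + G.p) * G.m₁ by ring]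
  have : 1 + G.p ≠ 0 := by positivity
  field_simp
  ring

theorem PPoA_eq_two_iff : G.PPoA = 2 ↔ (G.m₁ = G.m / 2 ∧ G.m₂ = G.m / 2) ∧ G.p = 0 := by
  constructor
  · intro h
    have hp0 := G.p_nonneg
    have hp : G.p = 0 := by
      have := G.PPoA_le
      rw [h, le_div_iff₀ (by linarith)] at this
      linarith
    obtain ⟨u, hu⟩ := G.exists_isPureNash
    refine ⟨hu.infiltration_le.2 ?_, hp⟩
    have hS := add_pos G.m₁_pos G.m₂_pos
    have hw := hu.welfare_bound
    have e := hu.PPoA_eq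
    rw [hp] at e hw
    rw [h, eq_div_iff (by linarith)] at e
    linarith
  · rintro ⟨⟨h₁, h₂⟩, hp⟩
    rw [PPoA_eq_of_eq_half h₁ h₂, hp]
    norm_num

theorem range_PPoA : Set.range PPoA = Set.Ioc 1 2 := by
  ext r
  constructor
  · rintro ⟨G, rfl⟩
    exact ⟨G.one_lt_PPoA, G.PPoA_le.trans G.two_div_le_two⟩
  · rintro ⟨h1, h2⟩
    have hr : 0 < r := by linarith
    -- Equal pools owning everything have price `2 / (1 + p)`; solve this for `p`.
    refine ⟨⟨2, 1, 1, 2 / r - 1, one_pos, one_pos, by norm_num, ?_, ?_⟩, ?_⟩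
    · rw [sub_nonneg, one_le_div hr]; exact h2
    · rw [sub_lt_iff_lt_add, div_lt_iff₀ hr]; linarith
    · rw [PPoA_eq_of_eq_half (by norm_num) (by norm_num)]
      simp only [add_sub_cancel]
      field_simp

end priceOfAnarchy

end MinersDilemma

theorem theorem3 :
    (∀ G : MinersDilemma,
      (∃! x : ℝ × ℝ, G.IsPureNash x) ∧
      (∀ x : ℝ × ℝ, G.IsPureNash x →
        G.PPoA = (G.m₁ + G.m₂) / (G.m₁ + G.m₂ - (1 - G.p) * (x.1 + x.2))) ∧
      1 < G.PPoA ∧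
      G.PPoA ≤ 2 / (1 + G.p) ∧
      2 / (1 + G.p) ≤ 2 ∧
      (G.PPoA = 2 ↔ (G.m₁ = G.m / 2 ∧ G.m₂ = G.m / 2) ∧ G.p = 0)) ∧
    (∀ ε : ℝ, 0 < ε → ∃ G : MinersDilemma, G.PPoA < 1 + ε) ∧
    Set.range MinersDilemma.PPoA = Set.Ioc 1 2 := by
  refine ⟨fun G => ⟨G.existsUnique_isPureNash, fun x hx => hx.PPoA_eq, G.one_lt_PPoA, G.PPoA_le,
    G.two_div_le_two, MinersDilemma.PPoA_eq_two_iff⟩, fun ε hε => ?_, MinersDilemma.range_PPoA⟩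
  have hmem : min 2 (1 + ε / 2) ∈ Set.range MinersDilemma.PPoA := by
    rw [MinersDilemma.range_PPoA]
    exact ⟨lt_min (by norm_num) (by linarith), min_le_left _ _⟩
  obtain ⟨G, hG⟩ := hmem
  exact ⟨G, by rw [hG]; exact (min_le_right _ _).trans_lt (by linarith)⟩
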